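/- For a finite graph $G$ with $n$ vertices, the bisection width $BW(G)$ is the minimum, over all vertex sets $S$ with $|S|=\lfloor n/2\rfloor$, of the number of edges of $G$ joining $S$ to its complement. Let $d\ge 1$ and let $k_1\ge k_2\ge\dots\ge k_d\ge 2$ be integers. For each $i$ let $G_i$ be a graph on $k_i$ vertices that is either the path $P_{k_i}$ or (possible only when $k_i=2^{j}-1$ for some $j$) the complete binary tree with $k_i$ vertices, in which all $j$ levels are full. Let $\mathit{MCTP}^{(d)}_{k_1,\dots,k_d}=G_1\times\dots\times G_d$ be the Cartesian product: two $d$-tuples are adjacent if and only if they differ in exactly one coordinate $i$ and their $i$-th coordinates are adjacent in $G_i$. Then $$BW\big(\mathit{MCTP}^{(d)}_{k_1,\dots,k_d}\big)=\sum_{i=1}^{e} C_i,\qquad C_i=\prod_{j=i+1}^{d}k_j,$$ where $e$ is the least index $i$ with $k_i$ even, and $e=d$ if all $k_i$ are odd. -/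

import Mathlib

namespace MCTP

/-- The number of edges of `G` that join a vertex of `S` to a vertex outside `S`.
(`interedges S Sᶜ` is the set of pairs `(u, v)` of adjacent vertices with `u ∈ S`, `v ∉ S`,
so every edge of the cut is counted exactly once.) -/
noncomputable def cutSize {V : Type*} [Fintype V] (G : SimpleGraph V) (S : Finset V) : ℕ :=
  open Classical in (G.interedges S Sᶜ).card

/-- The bisection width: the minimum of the cut size over all sets of `⌊n / 2⌋` vertices,
`n` being the number of vertices (such sets always exist). -/
noncomputable def bisectionWidth {V : Type*} [Fintype V] (G : SimpleGraph V) : ℕ :=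
  sInf {c : ℕ | ∃ S : Finset V, S.card = Fintype.card V / 2 ∧ cutSize G S = c}

/-- The Cartesian product of `d` graphs: two vertices are adjacent iff they are adjacent in one
coordinate and agree in all the others. -/
def cartesianProduct {d : ℕ} {V : Fin d → Type*} (G : ∀ i, SimpleGraph (V i)) :
    SimpleGraph (∀ i, V i) where
  Adj x y := ∃ i, (G i).Adj (x i) (y i) ∧ ∀ j, j ≠ i → x j = y j
  symm := ⟨fun _ _ ⟨i, h, h'⟩ => ⟨i, h.symm, fun j hj => (h' j hj).symm⟩⟩
  loopless := ⟨fun _ ⟨_, h, _⟩ => h.ne rfl⟩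

/-- The binary tree on `{0, …, k - 1}` in level order: the root is `0` and the children
of `v` are `2 v + 1` and `2 v + 2`. For `k = 2 ^ j - 1` it is the complete
binary tree with `j` (full) levels. -/
def binaryTree (k : ℕ) : SimpleGraph (Fin k) :=
  SimpleGraph.fromRel fun u v => (v : ℕ) = 2 * u + 1 ∨ (v : ℕ) = 2 * u + 2

/-- `G` is the complete binary tree on `k` vertices; in particular `k = 2 ^ j - 1` for
some `j ≥ 1`. -/
def IsCompleteBinaryTree {k : ℕ} (G : SimpleGraph (Fin k)) : Prop :=
  (∃ j : ℕ, 1 ≤ j ∧ k = 2 ^ j - 1) ∧ G = binaryTree k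

/-- `G` is the path on `k` vertices. -/
def IsPathGraph {k : ℕ} (G : SimpleGraph (Fin k)) : Prop :=
  G = SimpleGraph.pathGraph k

/-- The lowest dimension `e` (dimensions being numbered `1, …, d`) with an even number of
vertices, and `e = d` if there is none. The index `i : Fin d` stands for dimension `i + 1`. -/
noncomputable def lowestEvenDim {d : ℕ} (k : Fin d → ℕ) : ℕ :=
  open Classical in
  if ∃ i, Even (k i) then sInf {m : ℕ | ∃ i : Fin d, Even (k i) ∧ m = (i : ℕ) + 1} else d

/-- `C_i`, the product of the `k_j` over all `j > i`. -/
def C {d : ℕ} (k : Fin d → ℕ) (i : Fin d) : ℕ := ∏ j ∈ Finset.Ioi i, k j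

/-- `Ψ(e)`, the sum of `C_i` over the dimensions `1, …, e`. -/
def Psi {d : ℕ} (k : Fin d → ℕ) (e : ℕ) : ℕ :=
  ∑ i ∈ Finset.univ.filter (fun i : Fin d => (i : ℕ) + 1 ≤ e), C k i

end MCTP

/-!
For the lower bound, every nontrivial cut of a connected factor with `k` vertices has at least
`1 ≥ c * (k - c) / ⌊k² / 4⌋` edges, `c` being the number of vertices on one side. So the cut is at
least the boundary in the product of cliques in which the edges of each line of length `k` have
weight `1 / ⌊k² / 4⌋`. There, the lexicographic initial segments (longest dimension slowest) have
the least boundary, by induction on the dimension: the layers of a set may be taken to be initial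
segments of the smaller box, regrouping their pieces along the second coordinate makes the slices in
that direction initial segments too, and then the edge-isoperimetric inequality for the product of
two cliques, applied to the planes of the two slowest coordinates, and Jensen's inequality for
integers give the claim. The initial segment with half of the points has boundary
`Psi k (lowestEvenDim k)`.

Equality is attained by stacking middle cuts: half of the layers are full, and if their number is
odd, the middle layer is cut in the same way in the remaining coordinates.
-/

namespace MCTP

open Finset

section Isoperimetry

variable {ι : Type*}

/-- Twice the number of edges plus twice the number of vertices of the column-by-column initial
segment with `m` cells of a grid with columns of height `k`, all lines of the grid being cliques. -/
def segmentEnergy (k m : ℤ) : ℤ :=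
  k * (m / k) ^ 2 + 2 * (m / k) * (m % k) + m % k + (m / k) * k ^ 2 + (m % k) ^ 2

/-- Twice the number of edges plus twice the number of vertices of the set of cells that consists
of the bottom `a t` cells of each column `t ∈ s`, all lines of the grid being cliques. -/
def columnEnergy (s : Finset ι) (a : ι → ℤ) : ℤ :=
  ∑ t ∈ s, ∑ u ∈ s, min (a t) (a u) + ∑ t ∈ s, a t ^ 2

lemma segmentEnergy_add_self {k : ℤ} (hk : 0 < k) (m : ℤ) :
    segmentEnergy k (m + k) = segmentEnergy k m + k ^ 2 + k + 2 * m := by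
  have hdiv : (m + k) / k = m / k + 1 := by
    rw [Int.add_ediv_of_dvd_right dvd_rfl, Int.ediv_self hk.ne']
  simp only [segmentEnergy, hdiv, Int.add_emod_right]
  linear_combination 2 * Int.mul_ediv_add_emod m k

lemma segmentEnergy_of_lt {k m : ℤ} (h0 : 0 ≤ m) (h1 : m < k) : segmentEnergy k m = m + m ^ 2 := by
  simp [segmentEnergy, Int.ediv_eq_zero_of_lt h0 h1, Int.emod_eq_of_lt h0 h1]

lemma segmentEnergy_add_row_le (j : ℕ) {k : ℤ} (hk : 0 < k) (hj : j ≤ k) {m : ℤ} (h0 : 0 ≤ m)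
    (hm : m ≤ j * k) :
    segmentEnergy k m + (j ^ 2 + j + 2 * m) ≤ segmentEnergy (k + 1) (m + j) := by
  induction j generalizing m with
  | zero =>
    obtain rfl : m = 0 := by simp at hm; omega
    simp [segmentEnergy]
  | succ j ih =>
    push_cast at hj hm ⊢
    rcases le_or_gt k m with hkm | hkm
    · have hrec := ih (by omega) (m := m - k) (by omega) (by linarith)
      have hfst := segmentEnergy_add_self hk (m - k)
      have hsnd := segmentEnergy_add_self (k := k + 1) (by omega) (m - k + j)
      rw [sub_add_cancel] at hfst
      rw [show m - k + j + (k + 1) = m + (j + 1) by ring] at hsnd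
      linarith
    · rw [segmentEnergy_of_lt h0 hkm]
      rcases lt_or_ge (m + (j + 1)) (k + 1) with hlt | hge
      · rw [segmentEnergy_of_lt (by omega) hlt]
        nlinarith [mul_nonneg h0 (Int.natCast_nonneg j)]
      · have hsnd := segmentEnergy_add_self (k := k + 1) (by omega) (m + (j + 1) - (k + 1))
        rw [sub_add_cancel] at hsnd
        rw [hsnd, segmentEnergy_of_lt (by omega) (by omega)]
        nlinarith [mul_nonneg (sub_nonneg.2 (by omega : (j : ℤ) ≤ k)) (sub_nonneg.2 hkm.le)]

lemma columnEnergy_eq_erase [DecidableEq ι] {s : Finset ι} {x : ι} (hx : x ∈ s) (a : ι → ℤ) :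
    columnEnergy s a = columnEnergy (s.erase x) a +
      (2 * ∑ t ∈ s.erase x, min (a x) (a t) + a x + a x ^ 2) := by
  simp only [columnEnergy, ← add_sum_erase s _ hx, sum_add_distrib, min_self,
    fun t => min_comm (a t) (a x)]
  ring

lemma columnEnergy_erase_of_eq_zero [DecidableEq ι] {s : Finset ι} {x : ι} (hx : x ∈ s) {a : ι → ℤ}
    (h0 : ∀ t ∈ s, 0 ≤ a t) (hax : a x = 0) : columnEnergy (s.erase x) a = columnEnergy s a := by
  rw [columnEnergy_eq_erase hx, hax,
    sum_congr rfl fun t ht => min_eq_left (h0 t (mem_of_mem_erase ht))]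
  simp

lemma columnEnergy_eq_erase_of_le [DecidableEq ι] {s : Finset ι} {x : ι} (hx : x ∈ s) {a : ι → ℤ}
    (ha : ∀ t ∈ s, a t ≤ a x) :
    columnEnergy s a = columnEnergy (s.erase x) a +
      (2 * ∑ t ∈ s.erase x, a t + a x + a x ^ 2) := by
  rw [columnEnergy_eq_erase hx, sum_congr rfl fun t ht => min_eq_right (ha t (mem_of_mem_erase ht))]

lemma columnEnergy_sub_one (s : Finset ι) (a : ι → ℤ) :
    columnEnergy s a = columnEnergy s (fun t => a t - 1) +
      (#s ^ 2 + #s + 2 * ∑ t ∈ s, (a t - 1)) := by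
  simp only [columnEnergy, min_sub_sub_right, sub_sq, sum_add_distrib, sum_sub_distrib, sum_const,
    ← mul_sum, ← sum_mul, nsmul_eq_mul]
  ring

lemma columnEnergy_le_segmentEnergy_of_sub_one {k : ℤ} {s : Finset ι} (hne : s.Nonempty)
    {a : ι → ℤ} (h0 : ∀ t ∈ s, 0 ≤ a t - 1) (ha : ∀ t ∈ s, a t + 1 ≤ k) (hs : #s ≤ k)
    (hle : ∀ {l : ℤ}, k - 1 ≤ l → #s ≤ l →
      columnEnergy s (fun t => a t - 1) ≤ segmentEnergy l (∑ t ∈ s, (a t - 1))) :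
    columnEnergy s a ≤ segmentEnergy k (∑ t ∈ s, a t) := by
  have hcard := hne.card_pos
  have hsum : ∑ t ∈ s, a t = ∑ t ∈ s, (a t - 1) + #s := by simp
  rw [columnEnergy_sub_one, hsum]
  rcases hs.eq_or_lt with hs' | hs'
  · rw [hs', segmentEnergy_add_self (by omega)]
    linarith [hle (sub_le_self k zero_le_one) hs]
  · obtain ⟨k, rfl⟩ : ∃ l, k = l + 1 := ⟨k - 1, by ring⟩
    have hrow := segmentEnergy_add_row_le #s (k := k) (by omega) (by omega) (sum_nonneg h0)
      ((sum_le_card_nsmul _ _ _ fun t ht => by linarith [ha t ht]).trans_eq (nsmul_eq_mul _ _))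
    linarith [hle (l := k) (by omega) (by omega)]

/-- The edge-isoperimetric inequality for the product of two cliques. -/
theorem columnEnergy_le_segmentEnergy {k : ℤ} {s : Finset ι} {a : ι → ℤ} (h0 : ∀ t ∈ s, 0 ≤ a t)
    (ha : ∀ t ∈ s, a t ≤ k) (hs : #s ≤ k) :
    columnEnergy s a ≤ segmentEnergy k (∑ t ∈ s, a t) := by
  classical
  obtain ⟨n, hn⟩ : ∃ n : ℕ, #s + ∑ t ∈ s, a t ≤ n :=
    ⟨(#s + ∑ t ∈ s, a t).toNat, Int.self_le_toNat _⟩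
  induction n generalizing k s a with
  | zero =>
    have := sum_nonneg h0
    obtain rfl : s = ∅ := card_eq_zero.1 (by omega)
    simp [columnEnergy, segmentEnergy]
  | succ n ih =>
    rcases s.eq_empty_or_nonempty with rfl | hne
    · simp [columnEnergy, segmentEnergy]
    have hcard := hne.card_pos
    have hk : 0 < k := by omega
    have herase : ∀ x ∈ s, columnEnergy (s.erase x) a ≤ segmentEnergy k (∑ t ∈ s.erase x, a t) := by
      intro x hx
      have := card_erase_of_mem hx
      have := add_sum_erase s a hx
      have := h0 x hx
      exact ih (fun t ht => h0 t (mem_of_mem_erase ht)) (fun t ht => ha t (mem_of_mem_erase ht))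
        (by omega) (by omega)
    by_cases hz : ∃ x ∈ s, a x = 0
    · obtain ⟨x, hx, hx0⟩ := hz
      have hsum : ∑ t ∈ s.erase x, a t = ∑ t ∈ s, a t := sum_erase s hx0
      rw [← columnEnergy_erase_of_eq_zero hx h0 hx0, ← hsum]
      exact herase x hx
    by_cases hf : ∃ x ∈ s, a x = k
    · obtain ⟨x, hx, rfl⟩ := hf
      rw [columnEnergy_eq_erase_of_le hx ha, ← sum_erase_add s a hx, segmentEnergy_add_self hk]
      linarith [herase x hx]
    push Not at hz hf
    have h0' : ∀ t ∈ s, 0 ≤ a t - 1 := fun t ht => by have := h0 t ht; have := hz t ht; omega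
    have ha' : ∀ t ∈ s, a t + 1 ≤ k := fun t ht => by have := ha t ht; have := hf t ht; omega
    have hsum : ∑ t ∈ s, a t = ∑ t ∈ s, (a t - 1) + #s := by simp
    exact columnEnergy_le_segmentEnergy_of_sub_one hne h0' ha' hs
      fun hkl hl => ih h0' (fun t ht => by linarith [ha' t ht]) hl (by omega)

end Isoperimetry

section PairEnergy

variable {ι : Type*}

/-- `r * (k - r)` for the remainder `r` of `m` modulo `k`: twice the boundary of `m` cells that fill
up columns of height `k` one after the other. -/
def remProd (k m : ℤ) : ℤ := (m % k) * (k - m % k)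

/-- The sum of `|a t - a u| * (k - |a t - a u|)` over all ordered pairs, the interaction energy of
points `a t` on a cycle of length `k`. -/
def pairEnergy (k : ℤ) (s : Finset ι) (a : ι → ℤ) : ℤ :=
  ∑ t ∈ s, ∑ u ∈ s, |a t - a u| * (k - |a t - a u|)

lemma remProd_add_le {k : ℤ} (hk : 0 < k) (m : ℤ) {x : ℤ} (h0 : 0 ≤ x) (hx : x ≤ k) :
    remProd k (m + x) ≤ remProd k m + x * (k - x) := by
  have hr0 := Int.emod_nonneg m hk.ne'
  have hrk := Int.emod_lt_of_pos m hk
  have hmod : (m + x) % k = (m % k + x) % k := by simp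
  simp only [remProd, hmod]
  generalize m % k = r at *
  rcases lt_or_ge (r + x) k with h | h
  · rw [Int.emod_eq_of_lt (by omega) h]
    nlinarith [mul_nonneg hr0 h0]
  · rw [← Int.sub_emod_right]
    rcases hx.eq_or_lt with rfl | hx
    · rw [Int.emod_eq_of_lt (by omega) (by omega)]
      simp
    · rw [Int.emod_eq_of_lt (by omega) (by omega)]
      nlinarith [mul_nonneg (sub_nonneg.2 hrk.le) (sub_nonneg.2 hx.le)]

lemma remProd_sum_le {k : ℤ} (hk : 0 < k) {s : Finset ι} {a : ι → ℤ} (h0 : ∀ t ∈ s, 0 ≤ a t)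
    (ha : ∀ t ∈ s, a t ≤ k) : remProd k (∑ t ∈ s, a t) ≤ ∑ t ∈ s, a t * (k - a t) := by
  classical
  induction s using Finset.induction_on with
  | empty => simp [remProd]
  | insert x s hx ih =>
    rw [forall_mem_insert] at h0 ha
    rw [sum_insert hx, sum_insert hx, add_comm]
    linarith [remProd_add_le hk (∑ t ∈ s, a t) h0.1 ha.1, ih h0.2 ha.2]

lemma sum_sum_abs_sub (s : Finset ι) (a : ι → ℤ) :
    ∑ t ∈ s, ∑ u ∈ s, |a t - a u| =
      2 * #s * ∑ t ∈ s, a t - 2 * ∑ t ∈ s, ∑ u ∈ s, min (a t) (a u) := by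
  have habs : ∀ t u, |a t - a u| = a t + a u - 2 * min (a t) (a u) := fun t u => by grind
  simp only [habs, sum_sub_distrib, sum_add_distrib, sum_const, ← mul_sum, nsmul_eq_mul]
  ring

lemma sum_sum_sub_sq {R : Type*} [CommRing R] (s : Finset ι) (a : ι → R) :
    ∑ t ∈ s, ∑ u ∈ s, (a t - a u) ^ 2 =
      2 * #s * ∑ t ∈ s, a t ^ 2 - 2 * (∑ t ∈ s, a t) ^ 2 := by
  simp only [sub_sq, sum_sub_distrib, sum_add_distrib, sum_const, ← mul_sum, ← sum_mul,
    nsmul_eq_mul]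
  ring

lemma pairEnergy_eq (k : ℤ) (s : Finset ι) (a : ι → ℤ) :
    pairEnergy k s a =
      k * ∑ t ∈ s, ∑ u ∈ s, |a t - a u| - ∑ t ∈ s, ∑ u ∈ s, (a t - a u) ^ 2 := by
  simp only [pairEnergy, mul_sum, ← sum_sub_distrib, ← sq_abs (a _ - a _)]
  exact sum_congr rfl fun t _ => sum_congr rfl fun u _ => by ring

lemma pairEnergy_eq_erase [DecidableEq ι] (k : ℤ) {s : Finset ι} {x : ι} (hx : x ∈ s) (a : ι → ℤ) :
    pairEnergy k s a =
      pairEnergy k (s.erase x) a + 2 * ∑ u ∈ s, |a x - a u| * (k - |a x - a u|) := by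
  simp only [pairEnergy, ← add_sum_erase s _ hx, sum_add_distrib, sub_self,
    fun t => abs_sub_comm (a t) (a x)]
  simp only [abs_zero, sub_zero, zero_mul, zero_add]
  ring

lemma remProd_le_pairEnergy_of_card_eq {k : ℕ} {s : Finset ι} {a : ι → ℤ}
    (h0 : ∀ t ∈ s, 0 ≤ a t) (ha : ∀ t ∈ s, a t ≤ k) (hs : #s = k) :
    2 * (k - 1) * remProd k (∑ t ∈ s, a t) ≤ pairEnergy k s a := by
  have hiso := mul_le_mul_of_nonneg_left
    (columnEnergy_le_segmentEnergy h0 ha (by exact_mod_cast hs.le)) (Int.natCast_nonneg k)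
  rw [pairEnergy_eq, sum_sum_abs_sub, sum_sum_sub_sq, hs]
  simp only [segmentEnergy, columnEnergy] at hiso
  set m := ∑ t ∈ s, a t
  have hm := Int.mul_ediv_add_emod m k
  rw [remProd]
  generalize m / (k : ℤ) = p at *
  generalize m % (k : ℤ) = r at *
  rw [← hm]
  linarith

/-- The case of more than `k` points follows from the case of exactly `k` points by averaging over
all ways to remove one point. -/
theorem remProd_le_pairEnergy {k : ℕ} (hk : 2 ≤ k) {s : Finset ι} {a : ι → ℤ}
    (h0 : ∀ t ∈ s, 0 ≤ a t) (ha : ∀ t ∈ s, a t ≤ k) (hs : k ≤ #s) :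
    2 * #s * (#s - 1) * remProd k (∑ t ∈ s, a t) ≤
      2 * (#s - 1) * (#s - k) * ∑ t ∈ s, a t * (k - a t) + k * pairEnergy k s a := by
  classical
  obtain ⟨T, hT⟩ : ∃ T, T = #s := ⟨_, rfl⟩
  rw [← hT] at hs ⊢
  induction T, hs using Nat.le_induction generalizing s with
  | base =>
    linarith [mul_le_mul_of_nonneg_left (remProd_le_pairEnergy_of_card_eq h0 ha hT.symm)
      (Int.natCast_nonneg k)]
  | succ T hkT ih =>
    set m := ∑ t ∈ s, a t
    set X := ∑ t ∈ s, a t * (k - a t) with hX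
    have hT1 : (0 : ℤ) < T - 1 := by omega
    have herase : ∀ i ∈ s, 2 * (T : ℤ) * (T - 1) * (remProd k m - a i * (k - a i)) ≤
        2 * (T - 1) * (T - k) * (X - a i * (k - a i)) +
          k * (pairEnergy k s a - 2 * ∑ u ∈ s, |a i - a u| * (k - |a i - a u|)) := by
      intro i hi
      have hle := ih (s := s.erase i) (fun t ht => h0 t (mem_of_mem_erase ht))
        (fun t ht => ha t (mem_of_mem_erase ht)) (by rw [card_erase_of_mem hi]; omega)
      have hrem := remProd_add_le (by omega : (0 : ℤ) < k) (∑ t ∈ s.erase i, a t) (h0 i hi)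
        (ha i hi)
      rw [sum_erase_add s a hi] at hrem
      rw [← eq_sub_of_add_eq (pairEnergy_eq_erase k hi a).symm, ← sum_erase_eq_sub hi]
      exact (mul_le_mul_of_nonneg_left (by linarith) (mul_nonneg (by positivity) hT1.le)).trans hle
    have hsum := sum_le_sum herase
    simp only [← mul_sum, sum_add_distrib, sum_sub_distrib, sum_const, ← hT, ← hX,
      nsmul_eq_mul] at hsum
    rw [← pairEnergy] at hsum
    refine le_of_mul_le_mul_left ?_ hT1
    push_cast at hsum ⊢
    linarith

lemma sq_le_four_mul_quarter_add_one (n : ℕ) : n ^ 2 ≤ 4 * (n ^ 2 / 4) + 1 := by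
  have : n ^ 2 % 4 ≤ 1 := by
    rcases n.even_or_odd' with ⟨c, rfl | rfl⟩
    · rw [show (2 * c) ^ 2 = 4 * c ^ 2 by ring]; omega
    · rw [show (2 * c + 1) ^ 2 = 4 * (c ^ 2 + c) + 1 by ring]; omega
  omega

lemma quarter_mul_le {k T : ℕ} (h : k ≤ T) :
    ((k ^ 2 / 4 : ℕ) : ℤ) * (T ^ 2 - T + k) ≤ k ^ 2 * (T ^ 2 / 4 : ℕ) := by
  rcases h.eq_or_lt with rfl | h
  · linarith
  have hk : 4 * ((k ^ 2 / 4 : ℕ) : ℤ) ≤ k ^ 2 := by exact_mod_cast Nat.mul_div_le (k ^ 2) 4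
  have hT : (T : ℤ) ^ 2 ≤ 4 * (T ^ 2 / 4 : ℕ) + 1 := by
    exact_mod_cast sq_le_four_mul_quarter_add_one T
  have hkT : (T : ℤ) ^ 2 - T + k ≤ 4 * (T ^ 2 / 4 : ℕ) := by
    have : (k : ℤ) + 1 ≤ T := by exact_mod_cast h
    linarith
  have := mul_le_mul_of_nonneg_left hkT (Int.natCast_nonneg (k ^ 2 / 4))
  have := mul_le_mul_of_nonneg_right hk (Int.natCast_nonneg (T ^ 2 / 4))
  linarith

theorem quarter_mul_remProd_le {k : ℕ} (hk : 2 ≤ k) {s : Finset ι} {a : ι → ℤ}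
    (h0 : ∀ t ∈ s, 0 ≤ a t) (ha : ∀ t ∈ s, a t ≤ k) (hs : k ≤ #s) :
    2 * ((k * (#s ^ 2 / 4 : ℕ) : ℤ) - (k ^ 2 / 4 : ℕ)) * remProd k (∑ t ∈ s, a t) ≤
      2 * ((k * (#s ^ 2 / 4 : ℕ) : ℤ) - #s * (k ^ 2 / 4 : ℕ)) * ∑ t ∈ s, a t * (k - a t) +
        (k ^ 2 / 4 : ℕ) * pairEnergy k s a := by
  have hsum := remProd_sum_le (by omega : (0 : ℤ) < k) h0 ha
  have hpair := remProd_le_pairEnergy hk h0 ha hs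
  have hcoef := quarter_mul_le hs
  generalize #s = T at *
  generalize k ^ 2 / 4 = w at *
  generalize T ^ 2 / 4 = v at *
  refine le_of_mul_le_mul_left ?_ (by omega : (0 : ℤ) < k)
  linarith [mul_le_mul_of_nonneg_left hpair (Int.natCast_nonneg w),
    mul_le_mul_of_nonneg_left hsum (sub_nonneg.2 hcoef)]

end PairEnergy

section Layers

variable {M : Type*} [AddCommMonoid M]

lemma add_div_eq_div_add_mod_add_div (m θ N : ℕ) : (m + θ) / N = m / N + (m % N + θ) / N := by
  rcases N.eq_zero_or_pos with rfl | hN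
  · simp
  · conv_lhs => rw [← Nat.div_add_mod m N, add_assoc, Nat.mul_add_div hN]

lemma add_div_le_of_le_mul {k N a θ : ℕ} (hθ : θ < N) (ha : a ≤ k * N) : (a + θ) / N ≤ k :=
  Nat.lt_succ_iff.1 <| (Nat.div_lt_iff_lt_mul (by omega)).2 (by rw [Nat.succ_mul]; omega)

lemma sum_range_add_div {N : ℕ} (hN : 0 < N) (f : ℕ → M) (m : ℕ) :
    ∑ θ ∈ range N, f ((m + θ) / N) = (N - m % N) • f (m / N) + (m % N) • f (m / N + 1) := by
  have hr := Nat.mod_lt m hN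
  have hlow : ∀ θ ∈ range (N - m % N), f ((m + θ) / N) = f (m / N) := fun θ hθ => by
    rw [mem_range] at hθ
    rw [add_div_eq_div_add_mod_add_div, Nat.div_eq_of_lt (by omega : m % N + θ < N), add_zero]
  have hhigh : ∀ θ ∈ range (m % N), f ((m + (N - m % N + θ)) / N) = f (m / N + 1) := fun θ hθ => by
    rw [mem_range] at hθ
    rw [add_div_eq_div_add_mod_add_div, show m % N + (N - m % N + θ) = θ + N by omega,
      Nat.add_div_right _ hN, Nat.div_eq_of_lt (by omega : θ < N)]
  have hsplit := sum_range_add (fun θ => f ((m + θ) / N)) (N - m % N) (m % N)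
  rw [Nat.sub_add_cancel hr.le] at hsplit
  rw [hsplit, sum_congr rfl hlow, sum_congr rfl hhigh, sum_const, sum_const, card_range, card_range]

/-- Hermite's identity. -/
lemma sum_range_add_div_self {N : ℕ} (hN : 0 < N) (m : ℕ) : ∑ θ ∈ range N, (m + θ) / N = m := by
  rw [sum_range_add_div hN fun n => n, smul_eq_mul, smul_eq_mul]
  conv_rhs => rw [← Nat.div_add_mod m N]
  have := (Nat.mod_lt m hN).le
  zify [this]
  ring

/-- The number of cells in the `y`-th of the consecutive blocks of `N` cells when `a` cells are
filled one after the other. -/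
def blockPart (N a y : ℕ) : ℕ := min N (a - y * N)

lemma blockPart_le (N a y : ℕ) : blockPart N a y ≤ N := min_le_left _ _

lemma blockPart_mono (N y : ℕ) : Monotone fun a => blockPart N a y :=
  fun _ _ h => min_le_min_left _ (Nat.sub_le_sub_right h _)

lemma blockPart_anti (N a : ℕ) : Antitone (blockPart N a) :=
  fun _ _ h => min_le_min_left _ (Nat.sub_le_sub_left (Nat.mul_le_mul_right _ h) _)

lemma blockPart_add_div {N θ : ℕ} (hθ : θ < N) (a y : ℕ) :
    (blockPart N a y + θ) / N = if y < (a + θ) / N then 1 else 0 := by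
  have hlt : y < (a + θ) / N ↔ y * N + N ≤ a + θ := by
    rw [← Nat.succ_le_iff, Nat.le_div_iff_mul_le (by omega), Nat.succ_mul]
  simp only [hlt, blockPart]
  split_ifs with h
  · exact Nat.div_eq_of_lt_le (by omega) (by omega)
  · exact Nat.div_eq_of_lt (by omega)

lemma sum_blockPart_add_div {k N a θ : ℕ} (hθ : θ < N) (ha : a ≤ k * N) :
    ∑ y : Fin k, (blockPart N a y + θ) / N = (a + θ) / N := by
  simp only [blockPart_add_div hθ, sum_boole, Fin.card_filter_val_lt, Nat.cast_id,
    min_eq_right (add_div_le_of_le_mul hθ ha)]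

lemma sum_blockPart {k N a : ℕ} (ha : a ≤ k * N) : ∑ y : Fin k, blockPart N a y = a := by
  rcases N.eq_zero_or_pos with rfl | hN
  · simp [blockPart]; omega
  · calc ∑ y : Fin k, blockPart N a y
        = ∑ y : Fin k, ∑ θ ∈ range N, (blockPart N a y + θ) / N := by
          simp only [sum_range_add_div_self hN]
      _ = ∑ θ ∈ range N, (a + θ) / N := by
          rw [sum_comm]
          exact sum_congr rfl fun θ hθ => sum_blockPart_add_div (mem_range.1 hθ) ha
      _ = a := sum_range_add_div_self hN a

lemma sum_apply_blockPart {k N a : ℕ} (hN : 0 < N) (ha : a ≤ k * N) {f : ℕ → M} (h0 : f 0 = 0)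
    (hf : f N = 0) : ∑ y : Fin k, f (blockPart N a y) = f (a % N) := by
  have hdm := Nat.div_add_mod' a N
  have hr := Nat.mod_lt a hN
  rw [Fin.sum_univ_eq_sum_range fun y => f (blockPart N a y)]
  have hq : blockPart N a (a / N) = a % N := by rw [blockPart]; omega
  rw [← hq]
  refine sum_eq_single _ (fun y _ hy => ?_) fun hk => ?_
  · rcases lt_or_gt_of_ne hy with h | h
    · have := Nat.mul_le_mul_right N (Nat.succ_le_of_lt h)
      rw [Nat.succ_mul] at this
      rw [blockPart, min_eq_left (by omega), hf]
    · have := Nat.mul_le_mul_right N (Nat.succ_le_of_lt h)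
      rw [Nat.succ_mul] at this
      rw [blockPart, Nat.sub_eq_zero_of_le (by omega), Nat.min_zero, h0]
  · have := Nat.mul_le_mul_right N (not_lt.1 (mt mem_range.2 hk))
    rw [hq, show a % N = 0 by omega, h0]

end Layers

section Dispersion

variable {ι κ : Type*} [Fintype ι]

/-- The boundary `c * (k - c)` of `c` vertices of a clique with `k` vertices, divided by the number
`⌊k² / 4⌋` of edges in its balanced cut. -/
def lineBoundary (k c : ℕ) : ℚ := c * (k - c) / (k ^ 2 / 4 : ℕ)

/-- The sum of `|a t - a u|` over all unordered pairs, divided by `⌊n² / 4⌋` for `n` the number of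
indices: the normalized number of edges that leave the union of columns of heights `a t` in the
directions across the columns. -/
def dispersion (a : ι → ℕ) : ℚ :=
  (∑ t, ∑ u, |(a t : ℚ) - a u|) / 2 / (Fintype.card ι ^ 2 / 4 : ℕ)

lemma quarter_pos {k : ℕ} (hk : 2 ≤ k) : (0 : ℚ) < (k ^ 2 / 4 : ℕ) := by
  have : 0 < k ^ 2 / 4 := Nat.div_pos (by nlinarith) (by norm_num)
  exact_mod_cast this

@[simp] lemma lineBoundary_zero (k : ℕ) : lineBoundary k 0 = 0 := by simp [lineBoundary]

@[simp] lemma lineBoundary_self (k : ℕ) : lineBoundary k k = 0 := by simp [lineBoundary]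

lemma dispersion_sum_le (s : Finset κ) (F : κ → ι → ℕ) :
    dispersion (fun t => ∑ y ∈ s, F y t) ≤ ∑ y ∈ s, dispersion (F y) := by
  simp only [dispersion, ← sum_div, Nat.cast_sum, ← sum_sub_distrib]
  rw [sum_comm (s := s), sum_congr rfl fun t _ => sum_comm (s := s)]
  gcongr
  exact abs_sum_le_sum_abs _ _

lemma dispersion_sum_of_chain (s : Finset κ) {F : κ → ι → ℕ}
    (hF : ∀ t u, (∀ y, F y t ≤ F y u) ∨ ∀ y, F y u ≤ F y t) :
    dispersion (fun t => ∑ y ∈ s, F y t) = ∑ y ∈ s, dispersion (F y) := by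
  have habs : ∀ t u, |∑ y ∈ s, ((F y t : ℚ) - F y u)| = ∑ y ∈ s, |(F y t : ℚ) - F y u| := by
    intro t u
    have hnn : ∀ {a b : ℕ}, a ≤ b → 0 ≤ (b : ℚ) - a := fun h => sub_nonneg.2 (Nat.cast_le.2 h)
    rcases hF t u with h | h
    · rw [← abs_neg, ← sum_neg_distrib]
      simp only [neg_sub, abs_sub_comm (F _ t : ℚ)]
      rw [abs_sum_of_nonneg fun y _ => hnn (h y)]
      exact sum_congr rfl fun y _ => (abs_of_nonneg (hnn (h y))).symm
    · rw [abs_sum_of_nonneg fun y _ => hnn (h y)]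
      exact sum_congr rfl fun y _ => (abs_of_nonneg (hnn (h y))).symm
  simp only [dispersion, ← sum_div, Nat.cast_sum, ← sum_sub_distrib, habs]
  rw [sum_comm (s := s), sum_congr rfl fun t _ => sum_comm (s := s)]

lemma dispersion_of_le_one {a : ι → ℕ} (ha : ∀ t, a t ≤ 1) :
    dispersion a = lineBoundary (Fintype.card ι) (∑ t, a t) := by
  have habs : ∀ t u, |(a t : ℚ) - a u| = a t + a u - 2 * (a t * a u) := by
    intro t u
    have := ha t
    have := ha u
    interval_cases a t <;> interval_cases a u <;> norm_num
  simp only [dispersion, lineBoundary, habs, sum_sub_distrib, sum_add_distrib, ← mul_sum,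
    ← sum_mul, sum_const, card_univ, nsmul_eq_mul, Nat.cast_sum]
  ring

lemma dispersion_eq_sum_range {N : ℕ} (hN : 0 < N) (a : ι → ℕ) :
    dispersion a = ∑ θ ∈ range N, dispersion fun t => (a t + θ) / N := by
  rw [← dispersion_sum_of_chain]
  · simp only [sum_range_add_div_self hN]
  · exact fun t u => (le_total (a t) (a u)).imp
      (fun h θ => Nat.div_le_div_right (Nat.add_le_add_right h θ))
      (fun h θ => Nat.div_le_div_right (Nat.add_le_add_right h θ))

lemma dispersion_eq_sum_lineBoundary {N : ℕ} {a : ι → ℕ} (ha : ∀ t, a t ≤ N) (hN : 0 < N) :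
    dispersion a = ∑ θ ∈ range N, lineBoundary (Fintype.card ι) (∑ t, (a t + θ) / N) := by
  rw [dispersion_eq_sum_range hN]
  exact sum_congr rfl fun θ hθ => dispersion_of_le_one fun t =>
    add_div_le_of_le_mul (mem_range.1 hθ) ((ha t).trans_eq (one_mul N).symm)

end Dispersion

section LexBoundary

/-- The normalized boundary of the lexicographic initial segment with `m` points of the box whose
side lengths are listed from the slowest to the fastest coordinate, all lines of the box being
cliques. The sum runs over the lines in the direction of the slowest coordinate. -/
def lexBoundary : List ℕ → ℕ → ℚ
  | [], _ => 0
  | k :: L, m => ∑ θ ∈ range L.prod, lineBoundary k ((m + θ) / L.prod) + lexBoundary L (m % L.prod)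

/-- Among all sets that meet each of the `k` layers of the box `k :: L` in a lexicographic initial
segment, the lexicographic initial segment has minimal normalized boundary. -/
def LexOptimal (k : ℕ) (L : List ℕ) : Prop :=
  ∀ a : Fin k → ℕ, (∀ t, a t ≤ L.prod) →
    lexBoundary (k :: L) (∑ t, a t) ≤ ∑ t, lexBoundary L (a t) + dispersion a

@[simp] lemma lexBoundary_zero (L : List ℕ) : lexBoundary L 0 = 0 := by
  induction L with
  | nil => rfl
  | cons k L ih =>
    have hdiv : ∀ θ ∈ range L.prod, lineBoundary k ((0 + θ) / L.prod) = 0 := fun θ hθ => by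
      rw [zero_add, Nat.div_eq_of_lt (mem_range.1 hθ), lineBoundary_zero]
    rw [lexBoundary, sum_eq_zero hdiv, Nat.zero_mod, ih, add_zero]

lemma lexBoundary_prod (L : List ℕ) : lexBoundary L L.prod = 0 := by
  cases L with
  | nil => rfl
  | cons k L =>
    have hdiv : ∀ θ ∈ range L.prod, lineBoundary k ((k * L.prod + θ) / L.prod) = 0 := fun θ hθ => by
      have hθ := mem_range.1 hθ
      rw [mul_comm, Nat.mul_add_div (by omega), Nat.div_eq_of_lt hθ, add_zero, lineBoundary_self]
    rw [lexBoundary, List.prod_cons, sum_eq_zero hdiv, Nat.mul_mod_left, lexBoundary_zero, add_zero]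

lemma lexBoundary_singleton (k m : ℕ) : lexBoundary [k] m = lineBoundary k m := by
  simp [lexBoundary]

lemma lexBoundary_cons_eq_sum_blockPart {k a : ℕ} {L : List ℕ} (hL : 0 < L.prod)
    (ha : a ≤ k * L.prod) :
    lexBoundary (k :: L) a = ∑ y : Fin k, lexBoundary L (blockPart L.prod a y) +
      dispersion fun y : Fin k => blockPart L.prod a y := by
  rw [dispersion_eq_sum_lineBoundary (fun y => blockPart_le _ _ _) hL, Fintype.card_fin,
    sum_apply_blockPart hL ha (lexBoundary_zero L) (lexBoundary_prod L), lexBoundary, add_comm]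
  congr 1
  exact sum_congr rfl fun θ hθ => by rw [sum_blockPart_add_div (mem_range.1 hθ) ha]

/-- Cutting each of `k₁` columns of height `k₂ * L.prod` into `k₂` blocks and collecting equal
blocks transposes the box; the optimality for one coordinate less applies to each collection. -/
lemma LexOptimal.sum_transpose_le {k₁ : ℕ} {L : List ℕ} (h : LexOptimal k₁ L) (hL : 0 < L.prod)
    {k₂ : ℕ} {a : Fin k₁ → ℕ} (ha : ∀ t, a t ≤ k₂ * L.prod) :
    ∑ y : Fin k₂, lexBoundary (k₁ :: L) (∑ t, blockPart L.prod (a t) y) +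
        dispersion (fun y : Fin k₂ => ∑ t, blockPart L.prod (a t) y) ≤
      ∑ t, lexBoundary (k₂ :: L) (a t) + dispersion a := by
  have hrows : dispersion (fun y : Fin k₂ => ∑ t, blockPart L.prod (a t) y) =
      ∑ t, dispersion fun y : Fin k₂ => blockPart L.prod (a t) y :=
    dispersion_sum_of_chain _ fun y z => (le_total z y).imp
      (fun h _ => blockPart_anti _ _ h) (fun h _ => blockPart_anti _ _ h)
  have hcolumns : dispersion a =
      ∑ y : Fin k₂, dispersion fun t => blockPart L.prod (a t) y := by
    rw [← dispersion_sum_of_chain]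
    · simp only [sum_blockPart (ha _)]
    · exact fun t u => (le_total (a t) (a u)).imp
        (fun h _ => blockPart_mono _ _ h) (fun h _ => blockPart_mono _ _ h)
  calc _ ≤ ∑ y : Fin k₂, (∑ t, lexBoundary L (blockPart L.prod (a t) y) +
          dispersion fun t => blockPart L.prod (a t) y) +
        ∑ t, dispersion fun y : Fin k₂ => blockPart L.prod (a t) y := by
        rw [hrows]
        gcongr with y
        exact h _ fun t => blockPart_le _ _ _
    _ = ∑ t, (∑ y : Fin k₂, lexBoundary L (blockPart L.prod (a t) y) +
          dispersion fun y : Fin k₂ => blockPart L.prod (a t) y) + dispersion a := by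
        rw [hcolumns, sum_add_distrib, sum_add_distrib, sum_comm]
        ring
    _ = _ := by simp only [lexBoundary_cons_eq_sum_blockPart hL (ha _)]

end LexBoundary

section Plane

variable {k₁ k₂ : ℕ}

lemma lexBoundary_pair (hk₂ : 0 < k₂) (m : ℕ) :
    lexBoundary [k₁, k₂] m = m * (k₁ * k₂ - m) / (k₂ * (k₁ ^ 2 / 4 : ℕ)) +
      remProd k₂ m * (1 / (k₂ ^ 2 / 4 : ℕ) - 1 / (k₂ * (k₁ ^ 2 / 4 : ℕ))) := by
  have hk : (k₂ : ℚ) ≠ 0 := by exact_mod_cast hk₂.ne'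
  have hm : (m : ℚ) = k₂ * (m / k₂ : ℕ) + (m % k₂ : ℕ) := by
    exact_mod_cast (Nat.div_add_mod m k₂).symm
  have hrem : (remProd k₂ m : ℚ) = (m % k₂ : ℕ) * (k₂ - (m % k₂ : ℕ)) := by
    rw [remProd]; push_cast; rfl
  rw [lexBoundary, lexBoundary_singleton, List.prod_singleton, sum_range_add_div hk₂, hrem, hm]
  simp only [lineBoundary, nsmul_eq_mul, Nat.cast_sub (Nat.mod_lt m hk₂).le]
  generalize ((k₁ ^ 2 / 4 : ℕ) : ℚ) = q₁
  generalize ((k₂ ^ 2 / 4 : ℕ) : ℚ) = q₂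
  push_cast
  simp only [div_eq_mul_inv, mul_inv]
  field_simp
  ring

lemma lexOptimal_nil (k : ℕ) : LexOptimal k [] := by
  intro a ha
  rw [dispersion_of_le_one ha, Fintype.card_fin, lexBoundary_singleton]
  simp [lexBoundary]

theorem lexOptimal_singleton (hk₂ : 2 ≤ k₂) (hk : k₂ ≤ k₁) : LexOptimal k₁ [k₂] := by
  intro a ha
  have hq₁ := quarter_pos (hk₂.trans hk)
  have hq₂ := quarter_pos hk₂
  have : (0 : ℚ) < k₂ := by exact_mod_cast (by omega : 0 < k₂)
  have henergy := quarter_mul_remProd_le hk₂ (s := univ) (a := fun t => (a t : ℤ))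
    (fun t _ => Int.natCast_nonneg _) (fun t _ => by simpa using ha t) (by simpa using hk)
  rw [pairEnergy_eq, sum_sum_sub_sq, card_univ, Fintype.card_fin, ← Nat.cast_sum,
    ← Int.cast_le (R := ℚ)] at henergy
  have hlines : ∑ t, lexBoundary [k₂] (a t) = (∑ t, (a t : ℚ) * (k₂ - a t)) / (k₂ ^ 2 / 4 : ℕ) := by
    simp only [lexBoundary_singleton, lineBoundary, sum_div]
  have hsq : ∑ t, (a t : ℚ) ^ 2 = k₂ * (∑ t, a t : ℕ) - ∑ t, (a t : ℚ) * (k₂ - a t) := by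
    rw [Nat.cast_sum, mul_sum, ← sum_sub_distrib]
    exact sum_congr rfl fun t _ => by ring
  rw [lexBoundary_pair (by omega), hlines, dispersion, Fintype.card_fin]
  generalize k₁ ^ 2 / 4 = q₁ at *
  generalize k₂ ^ 2 / 4 = q₂ at *
  push_cast at henergy hsq ⊢
  rw [hsq] at henergy
  generalize ∑ t, (a t : ℚ) = m at *
  generalize ∑ t, (a t : ℚ) * (k₂ - a t) = X at *
  generalize ∑ t, ∑ u, |(a t : ℚ) - a u| = D at *
  generalize (remProd k₂ _ : ℚ) = R at *
  rw [← sub_nonneg]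
  have hsub : X / q₂ + D / 2 / q₁ - (m * (k₁ * k₂ - m) / (k₂ * q₁) + R * (1 / q₂ - 1 / (k₂ * q₁))) =
      (2 * (k₂ * q₁ - k₁ * q₂) * X + q₂ * (k₂ * D - (2 * k₁ * (k₂ * m - X) - 2 * m ^ 2)) -
        2 * (k₂ * q₁ - q₂) * R) / (2 * k₂ * q₁ * q₂) := by
    field_simp
    ring
  rw [hsub]
  exact div_nonneg (by linarith) (by positivity)

lemma sum_lexBoundary_pair_transpose_le (hk₂ : 2 ≤ k₂) (hk : k₂ ≤ k₁) {n : Fin k₂ → ℕ}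
    (hn : ∀ y, n y ≤ k₁) :
    lexBoundary [k₁, k₂] (∑ y, n y) ≤ ∑ y, lineBoundary k₁ (n y) + dispersion n := by
  have hn' : ∀ y, n y ≤ k₁ * [].prod := fun y => by simpa using hn y
  calc lexBoundary [k₁, k₂] (∑ y, n y)
      = lexBoundary [k₁, k₂] (∑ t : Fin k₁, ∑ y, blockPart 1 (n y) t) := by
        rw [sum_comm, sum_congr rfl fun y _ => (sum_blockPart (hn' y)).symm]
        simp
    _ ≤ ∑ t : Fin k₁, lexBoundary [k₂] (∑ y, blockPart 1 (n y) t) +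
          dispersion fun t : Fin k₁ => ∑ y, blockPart 1 (n y) t :=
        lexOptimal_singleton hk₂ hk _ fun t =>
          (sum_le_card_nsmul _ _ 1 fun y _ => blockPart_le _ _ _).trans (by simp)
    _ ≤ ∑ y, lexBoundary [k₁] (n y) + dispersion n :=
        (lexOptimal_nil k₂).sum_transpose_le (by simp) hn'
    _ = _ := by simp only [lexBoundary_singleton]

/-- `x ^ 2 + remProd k x` interpolates a parabola linearly between the multiples of `k`. -/
lemma sq_add_remProd_succ_sub {k : ℤ} (hk : 0 < k) (x : ℤ) :
    (x + 1) ^ 2 + remProd k (x + 1) - (x ^ 2 + remProd k x) = k * (2 * (x / k) + 1) := by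
  have hx := Int.mul_ediv_add_emod x k
  have hr := Int.emod_lt_of_pos x hk
  have hr0 := Int.emod_nonneg x hk.ne'
  have hmod : (x + 1) % k = (x % k + 1) % k := by simp
  rw [remProd, remProd, hmod]
  generalize x / k = p at *
  generalize x % k = r at *
  rcases (Int.add_one_le_of_lt hr).eq_or_lt with h | h
  · obtain rfl : r = k - 1 := by omega
    rw [h, Int.emod_self, ← hx]
    ring
  · rw [Int.emod_eq_of_lt (by omega) h, ← hx]
    ring

lemma monotone_lexBoundary_pair_sub_lineBoundary (hk₂ : 2 ≤ k₂) (hk : k₂ ≤ k₁) (b : ℕ) :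
    Monotone fun x : ℕ => (lexBoundary [k₁, k₂] (b + (x + 1)) - lineBoundary k₂ (x + 1)) -
      (lexBoundary [k₁, k₂] (b + x) - lineBoundary k₂ x) := by
  have hq₁ := quarter_pos (hk₂.trans hk)
  have hq₂ := quarter_pos hk₂
  have hcoef : (0 : ℚ) ≤ 1 / (k₂ ^ 2 / 4 : ℕ) - 1 / (k₂ * (k₁ ^ 2 / 4 : ℕ)) := by
    refine sub_nonneg.2 (one_div_le_one_div_of_le hq₂ ?_)
    have hle : k₂ ^ 2 / 4 ≤ k₁ ^ 2 / 4 := Nat.div_le_div_right (Nat.pow_le_pow_left hk 2)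
    exact_mod_cast hle.trans (Nat.le_mul_of_pos_left _ (by omega))
  have hdiff (x : ℕ) : (lexBoundary [k₁, k₂] (b + (x + 1)) - lineBoundary k₂ (x + 1)) -
      (lexBoundary [k₁, k₂] (b + x) - lineBoundary k₂ x) =
      (1 / (k₂ ^ 2 / 4 : ℕ) - 1 / (k₂ * (k₁ ^ 2 / 4 : ℕ))) * (k₂ * (2 * ((b + x) / k₂ : ℕ) + 1)) +
        (k₁ * k₂ / (k₂ * (k₁ ^ 2 / 4 : ℕ)) - (k₂ + 2 * b) / (k₂ ^ 2 / 4 : ℕ)) := by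
    have hpar := sq_add_remProd_succ_sub (by omega : (0 : ℤ) < k₂) (b + x)
    rw [add_assoc (b : ℤ) x 1, ← Nat.cast_add b x, ← Int.natCast_div,
      ← Int.cast_inj (α := ℚ)] at hpar
    simp only [lexBoundary_pair (by omega : 0 < k₂), lineBoundary]
    generalize k₁ ^ 2 / 4 = q₁ at *
    generalize k₂ ^ 2 / 4 = q₂ at *
    generalize (b + x) / k₂ = p at *
    push_cast at hpar ⊢
    linear_combination (1 / q₂ - 1 / (k₂ * q₁) : ℚ) * hpar
  intro x y hxy
  simp only [hdiff]
  gcongr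

end Plane

section Convexity

lemma add_mul_sub_le_of_monotone_sub {g : ℕ → ℚ} (hg : Monotone fun x => g (x + 1) - g x)
    (p n : ℕ) : g p + ((n : ℚ) - p) * (g (p + 1) - g p) ≤ g n := by
  rcases le_total p n with h | h
  · induction n, h using Nat.le_induction with
    | base => simp
    | succ n hpn ih =>
      have := hg hpn
      push_cast
      linarith
  · induction p, h using Nat.le_induction with
    | base => simp
    | succ p hnp ih =>
      have hmono : g (p + 1) - g p ≤ g (p + 1 + 1) - g (p + 1) := hg p.le_succ
      have := mul_le_mul_of_nonneg_left hmono
        (sub_nonneg.2 (Nat.cast_le.2 (hnp.trans p.le_succ)) : (0 : ℚ) ≤ (p + 1 : ℕ) - n)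
      push_cast at this ⊢
      linarith

/-- Jensen's inequality for integers. -/
lemma sum_range_add_div_le {N m : ℕ} (hN : 0 < N) {g : ℕ → ℚ}
    (hg : Monotone fun x => g (x + 1) - g x) {σ : ℕ → ℕ} (hσ : ∑ θ ∈ range N, σ θ = m) :
    ∑ θ ∈ range N, g ((m + θ) / N) ≤ ∑ θ ∈ range N, g (σ θ) := by
  have hm : (m : ℚ) = N * (m / N : ℕ) + (m % N : ℕ) := by
    exact_mod_cast (Nat.div_add_mod m N).symm
  have hcast : ∑ θ ∈ range N, (σ θ : ℚ) = m := by exact_mod_cast hσ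
  calc ∑ θ ∈ range N, g ((m + θ) / N)
      = ∑ θ ∈ range N, (g (m / N) + ((σ θ : ℚ) - (m / N : ℕ)) * (g (m / N + 1) - g (m / N))) := by
        rw [sum_range_add_div hN]
        simp only [sum_add_distrib, ← sum_mul, sum_sub_distrib, sum_const, card_range,
          nsmul_eq_mul, hcast, hm, Nat.cast_sub (Nat.mod_lt m hN).le]
        ring
    _ ≤ _ := sum_le_sum fun θ _ => add_mul_sub_le_of_monotone_sub hg _ _

end Convexity

section Optimality

variable {k₁ k₂ : ℕ} {L : List ℕ}

lemma sum_range_mul {M : Type*} [AddCommMonoid M] (m n : ℕ) (f : ℕ → M) :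
    ∑ i ∈ range (m * n), f i = ∑ φ ∈ range m, ∑ θ ∈ range n, f (θ + φ * n) := by
  induction m with
  | zero => simp
  | succ m ih =>
    rw [Nat.succ_mul, sum_range_add, ih, sum_range_succ]
    simp only [add_comm (m * n)]

lemma lineBoundary_mod {k n : ℕ} (hn : n ≤ k) : lineBoundary k (n % k) = lineBoundary k n := by
  rcases hn.eq_or_lt with rfl | hn
  · simp
  · rw [Nat.mod_eq_of_lt hn]

lemma lexBoundary_cons_cons (hL : 0 < L.prod) (hk₂ : 0 < k₂) (m : ℕ) :
    lexBoundary (k₁ :: k₂ :: L) m =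
      ∑ θ ∈ range L.prod, lexBoundary [k₁, k₂] ((m + θ) / L.prod) +
        lexBoundary L (m % L.prod) := by
  set N := L.prod with hN
  have houter : ∀ φ θ, (m + (θ + φ * N)) / (k₂ * N) = ((m + θ) / N + φ) / k₂ := fun φ θ => by
    rw [← add_assoc, mul_comm k₂, ← Nat.div_div_eq_div_mul, Nat.add_mul_div_right _ _ hL]
  have hinner : ∀ θ ∈ range N, lineBoundary k₂ ((m % (k₂ * N) + θ) / N) =
      lineBoundary k₂ ((m + θ) / N % k₂) := fun θ hθ => by
    have hle : (m % (k₂ * N) + θ) / N ≤ k₂ :=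
      add_div_le_of_le_mul (mem_range.1 hθ) (Nat.mod_lt m (Nat.mul_pos hk₂ hL)).le
    have hsplit : m + θ = m % (k₂ * N) + θ + k₂ * (m / (k₂ * N)) * N := by
      have := Nat.mod_add_div m (k₂ * N)
      rw [mul_right_comm] at this
      omega
    rw [← lineBoundary_mod hle, hsplit, Nat.add_mul_div_right _ _ hL, Nat.add_mul_mod_self_left]
  rw [lexBoundary, lexBoundary, List.prod_cons, sum_range_mul, sum_comm, ← hN,
    Nat.mod_mul_left_mod, ← add_assoc, sum_congr rfl hinner, ← sum_add_distrib]
  congr 1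
  refine sum_congr rfl fun θ _ => ?_
  rw [lexBoundary, lexBoundary_singleton, List.prod_singleton]
  simp only [houter]

lemma lexBoundary_cons_cons_add_mul (hL : 0 < L.prod) (hk₂ : 0 < k₂) (r b : ℕ) :
    lexBoundary (k₁ :: k₂ :: L) (r + L.prod * b) =
      ∑ θ ∈ range L.prod, lexBoundary [k₁, k₂] (b + (r + θ) / L.prod) +
        lexBoundary L (r % L.prod) := by
  rw [lexBoundary_cons_cons hL hk₂, Nat.add_mul_mod_self_left]
  congr 1
  refine sum_congr rfl fun θ _ => ?_
  rw [add_right_comm, Nat.add_mul_div_left _ _ hL, add_comm]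

lemma sum_lexBoundary_cons_add_dispersion {ι : Type*} [Fintype ι] (hL : 0 < L.prod)
    (n : ι → ℕ) :
    ∑ y, lexBoundary (k₁ :: L) (n y) + dispersion n =
      ∑ θ ∈ range L.prod, (∑ y, lineBoundary k₁ ((n y + θ) / L.prod) +
        dispersion fun y => (n y + θ) / L.prod) + ∑ y, lexBoundary L (n y % L.prod) := by
  rw [dispersion_eq_sum_range hL, sum_add_distrib, sum_comm]
  simp only [lexBoundary, sum_add_distrib]
  ring

/-- The lines in the direction of the slowest coordinate fall into `L.prod` planes; the
two-dimensional case applies to each of them and `LexOptimal k₂ L` to what is left over. -/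
lemma LexOptimal.le_sum_lexBoundary_skip (h : LexOptimal k₂ L) (hL : 0 < L.prod) (hk₂ : 2 ≤ k₂)
    (hk : k₂ ≤ k₁) {n : Fin k₂ → ℕ} (hn : ∀ y, n y ≤ k₁ * L.prod) :
    lexBoundary (k₁ :: k₂ :: L) (∑ y, n y) ≤
      ∑ y, lexBoundary (k₁ :: L) (n y) + dispersion n := by
  set N := L.prod
  set b := ∑ y, n y / N with hb
  set r := ∑ y, n y % N with hr
  set σ : ℕ → ℕ := fun θ => ∑ y, (n y % N + θ) / N with hσ
  have hσsum : ∑ θ ∈ range N, σ θ = r := by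
    rw [hσ, sum_comm]
    simp only [sum_range_add_div_self hL, hr]
  have hsum : ∑ y, n y = r + N * b := by
    rw [hr, hb, mul_sum, ← sum_add_distrib]
    simp only [Nat.mod_add_div]
  have hplane : ∀ θ ∈ range N, lexBoundary [k₁, k₂] (b + σ θ) ≤
      ∑ y, lineBoundary k₁ ((n y + θ) / N) + dispersion fun y => (n y + θ) / N := fun θ hθ => by
    have hbσ : b + σ θ = ∑ y, (n y + θ) / N := by
      simp only [hb, hσ, ← sum_add_distrib, ← add_div_eq_div_add_mod_add_div]
    rw [hbσ]
    exact sum_lexBoundary_pair_transpose_le hk₂ hk fun y =>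
      add_div_le_of_le_mul (mem_range.1 hθ) (hn y)
  have hrest : ∑ θ ∈ range N, lineBoundary k₂ ((r + θ) / N) + lexBoundary L (r % N) ≤
      ∑ y, lexBoundary L (n y % N) + ∑ θ ∈ range N, lineBoundary k₂ (σ θ) := by
    have hopt := h (fun y => n y % N) fun y => (Nat.mod_lt _ hL).le
    rwa [dispersion_eq_sum_lineBoundary (fun y => (Nat.mod_lt (n y) hL).le) hL,
      Fintype.card_fin] at hopt
  have hjensen := sum_range_add_div_le hL
    (g := fun x => lexBoundary [k₁, k₂] (b + x) - lineBoundary k₂ x)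
    (monotone_lexBoundary_pair_sub_lineBoundary hk₂ hk b) hσsum
  simp only [sum_sub_distrib] at hjensen
  rw [hsum, lexBoundary_cons_cons_add_mul hL (by omega), sum_lexBoundary_cons_add_dispersion hL]
  linarith [sum_le_sum hplane]

theorem lexOptimal {k : ℕ} (h2 : ∀ x ∈ k :: L, 2 ≤ x) (hmono : (k :: L).Pairwise (· ≥ ·)) :
    LexOptimal k L := by
  induction L generalizing k with
  | nil => exact lexOptimal_nil k
  | cons k₂ L ih =>
    simp only [List.forall_mem_cons, List.pairwise_cons] at h2 hmono ih
    obtain ⟨hk, hk₂, hL⟩ := h2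
    have hprod : 0 < L.prod := List.prod_pos fun x hx => by have := hL x hx; omega
    intro a ha
    simp only [List.prod_cons] at ha
    set n : Fin k₂ → ℕ := fun y => ∑ t, blockPart L.prod (a t) y with hn
    have hsum : ∑ y, n y = ∑ t, a t := by
      rw [hn, sum_comm]
      simp only [sum_blockPart (ha _)]
    have hle : ∀ y, n y ≤ k * L.prod := fun y =>
      (sum_le_card_nsmul _ _ _ fun t _ => blockPart_le _ _ _).trans (by simp)
    calc lexBoundary (k :: k₂ :: L) (∑ t, a t)
        = lexBoundary (k :: k₂ :: L) (∑ y, n y) := by rw [hsum]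
      _ ≤ ∑ y, lexBoundary (k :: L) (n y) + dispersion n :=
        (ih ⟨hk₂, hL⟩ hmono.2).le_sum_lexBoundary_skip hprod hk₂ (hmono.1.1) hle
      _ ≤ ∑ t, lexBoundary (k₂ :: L) (a t) + dispersion a :=
        (ih ⟨hk, hL⟩ ⟨hmono.1.2, hmono.2.2⟩).sum_transpose_le hprod ha

end Optimality

section Cuts

variable {V : Type*} {G : SimpleGraph V} {S : Finset V}

/-- The indicator of the ordered pairs `(u, v)` that `cutSize G S` counts; summing it over all pairs
lets a cut of a product be split coordinate by coordinate. -/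
noncomputable def cutIndicator (G : SimpleGraph V) (S : Finset V) (u v : V) : ℕ :=
  open Classical in if u ∈ S ∧ v ∉ S ∧ G.Adj u v then 1 else 0

variable [Fintype V]

lemma mem_interedges_compl [DecidableEq V] [DecidableRel G.Adj] {u v : V} :
    (u, v) ∈ G.interedges S Sᶜ ↔ u ∈ S ∧ v ∉ S ∧ G.Adj u v := by
  rw [SimpleGraph.mem_interedges_iff, mem_compl]

lemma cutSize_eq_sum (G : SimpleGraph V) (S : Finset V) :
    cutSize G S = ∑ u, ∑ v, cutIndicator G S u v := by
  classical
  simp only [cutIndicator]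
  rw [cutSize, ← Fintype.sum_prod_type', ← sum_filter, ← card_eq_sum_ones]
  congr 1
  ext ⟨u, v⟩
  simp only [mem_interedges_compl, mem_filter, mem_univ, true_and]

lemma cutSize_empty (G : SimpleGraph V) : cutSize G ∅ = 0 := by
  simp [cutSize_eq_sum, cutIndicator]

lemma cutSize_univ (G : SimpleGraph V) : cutSize G univ = 0 := by
  simp [cutSize_eq_sum, cutIndicator]

lemma cutSize_eq_one {a b : V} (ha : a ∈ S) (hb : b ∉ S) (hab : G.Adj a b)
    (h : ∀ u ∈ S, ∀ v ∉ S, G.Adj u v → u = a ∧ v = b) : cutSize G S = 1 := by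
  classical
  rw [cutSize, card_eq_one]
  refine ⟨(a, b), ext fun ⟨u, v⟩ => ?_⟩
  rw [mem_interedges_compl, mem_singleton, Prod.mk.injEq]
  constructor
  · rintro ⟨hu, hv, huv⟩
    exact h u hu v hv huv
  · rintro ⟨rfl, rfl⟩
    exact ⟨ha, hb, hab⟩

lemma one_le_cutSize (hG : G.Preconnected) (h0 : S.Nonempty) (h1 : S ≠ univ) :
    1 ≤ cutSize G S := by
  classical
  obtain ⟨a, ha⟩ := h0
  obtain ⟨b, hb⟩ : ∃ b, b ∉ S := by simpa [eq_univ_iff_forall] using h1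
  obtain ⟨p⟩ := hG a b
  obtain ⟨e, -, hfst, hsnd⟩ :=
    p.exists_boundary_dart (S : Set V) (mem_coe.2 ha) (mt mem_coe.1 hb)
  rw [cutSize, Nat.one_le_iff_ne_zero, ← Nat.pos_iff_ne_zero, card_pos]
  exact ⟨(e.fst, e.snd), mem_interedges_compl.2 ⟨mem_coe.1 hfst, mt mem_coe.2 hsnd, e.adj⟩⟩

lemma lineBoundary_le_one {k c : ℕ} (hk : 2 ≤ k) (hc : c ≤ k) : lineBoundary k c ≤ 1 := by
  rw [lineBoundary, div_le_one (quarter_pos hk), ← Nat.cast_sub hc, ← Nat.cast_mul, Nat.cast_le,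
    Nat.le_div_iff_mul_le (by norm_num)]
  obtain ⟨b, rfl⟩ := Nat.exists_eq_add_of_le hc
  rw [Nat.add_sub_cancel_left]
  zify
  linarith [sq_nonneg ((c : ℤ) - b), add_sq (c : ℤ) b, sub_sq (c : ℤ) b]

lemma lineBoundary_le_cutSize (hV : 2 ≤ Fintype.card V) (hG : G.Preconnected) (S : Finset V) :
    lineBoundary (Fintype.card V) #S ≤ cutSize G S := by
  rcases S.eq_empty_or_nonempty with rfl | h0
  · simp
  rcases eq_or_ne S univ with rfl | h1
  · simp
  calc lineBoundary (Fintype.card V) #S ≤ 1 := lineBoundary_le_one hV (card_le_univ S)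
    _ ≤ cutSize G S := by exact_mod_cast one_le_cutSize hG h0 h1

end Cuts

section Slices

variable {d : ℕ} {V : Fin (d + 1) → Type*}

lemma cartesianProduct_adj_cons (G : ∀ i, SimpleGraph (V i)) (t u : V 0)
    (x y : ∀ i : Fin d, V i.succ) :
    (cartesianProduct G).Adj (Fin.cons t x) (Fin.cons u y) ↔
      ((G 0).Adj t u ∧ x = y) ∨ (t = u ∧ (cartesianProduct fun i => G i.succ).Adj x y) := by
  simp only [cartesianProduct, Fin.exists_fin_succ, Fin.forall_fin_succ, Fin.cons_zero,
    Fin.cons_succ, ne_eq, not_true_eq_false, false_implies, true_and, Fin.succ_ne_zero,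
    not_false_eq_true, true_implies, funext_iff, (Fin.succ_ne_zero _).symm, Fin.succ_inj,
    and_left_comm (b := t = u), exists_and_left]

variable [∀ i, Fintype (V i)]

/-- The points of `S` on the line in direction `0` through `x`. -/
noncomputable def lineSlice (S : Finset (∀ i, V i)) (x : ∀ i : Fin d, V i.succ) : Finset (V 0) :=
  open Classical in univ.filter fun t => (Fin.cons t x : ∀ i, V i) ∈ S

/-- The layer of `S` at first coordinate `t`. -/
noncomputable def tailSlice (S : Finset (∀ i, V i)) (t : V 0) : Finset (∀ i : Fin d, V i.succ) :=
  open Classical in univ.filter fun x => (Fin.cons t x : ∀ i, V i) ∈ S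

@[simp] lemma mem_lineSlice {S : Finset (∀ i, V i)} {x : ∀ i : Fin d, V i.succ} {t : V 0} :
    t ∈ lineSlice S x ↔ (Fin.cons t x : ∀ i, V i) ∈ S := by simp [lineSlice]

@[simp] lemma mem_tailSlice {S : Finset (∀ i, V i)} {x : ∀ i : Fin d, V i.succ} {t : V 0} :
    x ∈ tailSlice S t ↔ (Fin.cons t x : ∀ i, V i) ∈ S := by simp [tailSlice]

lemma sum_cons {M : Type*} [AddCommMonoid M] (g : (∀ i, V i) → M) :
    ∑ x, g x = ∑ t : V 0, ∑ x : ∀ i : Fin d, V i.succ, g (Fin.cons t x) := by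
  rw [← (Fin.consEquiv V).sum_comp, Fintype.sum_prod_type]
  rfl

lemma card_eq_sum_tailSlice (S : Finset (∀ i, V i)) : #S = ∑ t, #(tailSlice S t) := by
  classical
  simp only [tailSlice, card_filter, ← sum_cons fun x => if x ∈ S then 1 else 0]
  simp

lemma dispersion_card_tailSlice_le (S : Finset (∀ i, V i)) :
    dispersion (fun t => #(tailSlice S t)) ≤
      ∑ x, lineBoundary (Fintype.card (V 0)) #(lineSlice S x) := by
  classical
  simp only [tailSlice, lineSlice, card_filter]
  refine (dispersion_sum_le univ _).trans_eq (sum_congr rfl fun x _ => ?_)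
  exact dispersion_of_le_one fun t => by split_ifs <;> simp

lemma cutIndicator_cons (G : ∀ i, SimpleGraph (V i)) (S : Finset (∀ i, V i)) (t u : V 0)
    (x y : ∀ i : Fin d, V i.succ) [Decidable (x = y)] [Decidable (t = u)] :
    cutIndicator (cartesianProduct G) S (Fin.cons t x) (Fin.cons u y) =
      (if x = y then cutIndicator (G 0) (lineSlice S x) t u else 0) +
      if t = u then cutIndicator (cartesianProduct fun i => G i.succ) (tailSlice S t) x y
        else 0 := by
  classical
  simp only [cutIndicator, mem_lineSlice, mem_tailSlice, cartesianProduct_adj_cons]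
  by_cases hxy : x = y <;> by_cases htu : t = u <;> simp [hxy, htu]

lemma cutSize_cartesianProduct (G : ∀ i, SimpleGraph (V i)) (S : Finset (∀ i, V i)) :
    cutSize (cartesianProduct G) S = ∑ x, cutSize (G 0) (lineSlice S x) +
      ∑ t, cutSize (cartesianProduct fun i => G i.succ) (tailSlice S t) := by
  classical
  simp only [cutSize_eq_sum, sum_cons, cutIndicator_cons, sum_add_distrib, sum_ite_eq, mem_univ,
    if_true]
  congr 1
  · exact sum_comm
  · refine sum_congr rfl fun t _ => sum_congr rfl fun x _ => ?_
    rw [sum_comm]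
    simp only [sum_ite_eq, mem_univ, if_true]

end Slices

section LowerBound

lemma dispersion_comp_equiv {ι κ : Type*} [Fintype ι] [Fintype κ] (e : ι ≃ κ) (a : κ → ℕ) :
    dispersion (fun t => a (e t)) = dispersion a := by
  rw [dispersion, dispersion, Fintype.card_congr e, ← e.sum_comp]
  simp only [← e.sum_comp fun u => |(a (e _) : ℚ) - a u|]

lemma LexOptimal.le_sum {ι : Type*} [Fintype ι] {L : List ℕ} (h : LexOptimal (Fintype.card ι) L)
    {a : ι → ℕ} (ha : ∀ t, a t ≤ L.prod) :
    lexBoundary (Fintype.card ι :: L) (∑ t, a t) ≤ ∑ t, lexBoundary L (a t) + dispersion a := by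
  let e := (Fintype.equivFin ι).symm
  rw [← e.sum_comp a, ← e.sum_comp fun t => lexBoundary L (a t), ← dispersion_comp_equiv e]
  exact h _ fun t => ha (e t)

theorem lexBoundary_le_cutSize {d : ℕ} {V : Fin d → Type*} [∀ i, Fintype (V i)]
    (hV : ∀ i, 2 ≤ Fintype.card (V i)) (hmono : Antitone fun i => Fintype.card (V i))
    {G : ∀ i, SimpleGraph (V i)} (hG : ∀ i, (G i).Preconnected) (S : Finset (∀ i, V i)) :
    lexBoundary (List.ofFn fun i => Fintype.card (V i)) #S ≤ cutSize (cartesianProduct G) S := by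
  induction d with
  | zero => simp [lexBoundary]
  | succ d ih =>
    have hoptimal : LexOptimal (Fintype.card (V 0))
        (List.ofFn fun i : Fin d => Fintype.card (V i.succ)) := by
      refine lexOptimal ?_ ?_ <;> rw [← List.ofFn_succ (f := fun i => Fintype.card (V i))]
      · exact List.forall_mem_ofFn_iff.2 hV
      · exact List.pairwise_ofFn.2 fun i j hij => hmono hij.le
    have hcard : ∀ t, #(tailSlice S t) ≤
        (List.ofFn fun i : Fin d => Fintype.card (V i.succ)).prod := fun t => by
      rw [List.prod_ofFn, ← Fintype.card_pi]
      exact card_le_univ _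
    calc lexBoundary (List.ofFn fun i => Fintype.card (V i)) #S
        ≤ ∑ t, lexBoundary (List.ofFn fun i : Fin d => Fintype.card (V i.succ)) #(tailSlice S t) +
            dispersion fun t => #(tailSlice S t) := by
          rw [List.ofFn_succ, card_eq_sum_tailSlice]
          exact hoptimal.le_sum hcard
      _ ≤ ∑ t, (cutSize (cartesianProduct fun i => G i.succ) (tailSlice S t) : ℚ) +
            ∑ x, (cutSize (G 0) (lineSlice S x) : ℚ) := by
          refine add_le_add (sum_le_sum fun t _ => ?_)
            ((dispersion_card_tailSlice_le S).trans (sum_le_sum fun x _ => ?_))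
          · exact ih (fun i => hV i.succ) (fun i j hij => hmono (Fin.succ_le_succ_iff.2 hij))
              (fun i => hG i.succ) _
          · exact lineBoundary_le_cutSize (hV 0) (hG 0) _
      _ = cutSize (cartesianProduct G) S := by
          rw [cutSize_cartesianProduct]
          push_cast
          ring

end LowerBound

section HalfBoundary

variable {d : ℕ} (k : Fin (d + 1) → ℕ)

lemma Psi_zero {d : ℕ} (k : Fin d → ℕ) : Psi k 0 = 0 := by simp [Psi]

lemma Psi_succ (e : ℕ) : Psi k (e + 1) = ∏ i : Fin d, k i.succ + Psi (fun i => k i.succ) e := by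
  simp only [Psi, C, sum_filter, Fin.sum_univ_succ, Fin.prod_Ioi_zero, Fin.prod_Ioi_succ,
    Fin.val_zero, Fin.val_succ, add_le_add_iff_right, zero_le, if_true]

variable {k}

lemma lowestEvenDim_of_even (h : Even (k 0)) : lowestEvenDim k = 1 := by
  rw [lowestEvenDim, if_pos ⟨0, h⟩]
  refine le_antisymm (Nat.sInf_le ⟨0, h, rfl⟩) (le_csInf ⟨1, 0, h, rfl⟩ ?_)
  rintro m ⟨i, -, rfl⟩
  omega

lemma lowestEvenDim_of_not_even (h : ¬ Even (k 0)) :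
    lowestEvenDim k = lowestEvenDim (fun i => k i.succ) + 1 := by
  have hexists : (∃ i, Even (k i)) ↔ ∃ i : Fin d, Even (k i.succ) := by
    rw [Fin.exists_fin_succ, or_iff_right h]
  simp only [lowestEvenDim, hexists]
  split_ifs with heven
  · have hpos : 1 ≤ sInf {m : ℕ | ∃ i, Even (k i) ∧ m = (i : ℕ) + 1} := by
      obtain ⟨i, hi⟩ := heven
      refine le_csInf ⟨_, i.succ, hi, rfl⟩ ?_
      rintro m ⟨i, -, rfl⟩
      omega
    rw [← Nat.sInf_add hpos]
    simp only [Fin.exists_fin_succ, h, false_and, false_or, add_left_inj, Fin.val_succ]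
  · rfl

variable (k) in
lemma Psi_lowestEvenDim_succ : Psi k (lowestEvenDim k) = ∏ i : Fin d, k i.succ +
    k 0 % 2 * Psi (fun i => k i.succ) (lowestEvenDim fun i => k i.succ) := by
  by_cases h : Even (k 0)
  · rw [lowestEvenDim_of_even h, Psi_succ, Psi_zero, Nat.even_iff.1 h, zero_mul]
  · rw [lowestEvenDim_of_not_even h, Psi_succ, Nat.not_even_iff.1 h, one_mul]

lemma lineBoundary_eq_one {k c : ℕ} (hk : 2 ≤ k) (hlow : k / 2 ≤ c) (hhigh : c ≤ (k + 1) / 2) :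
    lineBoundary k c = 1 := by
  have hcard : c * (k - c) = k ^ 2 / 4 := by
    rcases Nat.even_or_odd' k with ⟨h, rfl | rfl⟩
    · obtain rfl : c = h := by omega
      rw [show 2 * c - c = c by omega, show (2 * c) ^ 2 = 4 * (c * c) by ring]
      omega
    · have hsq : (2 * h + 1) ^ 2 / 4 = h * (h + 1) := by
        rw [show (2 * h + 1) ^ 2 = 4 * (h * (h + 1)) + 1 by ring]
        omega
      obtain rfl | rfl : c = h ∨ c = h + 1 := by omega
      · rw [hsq, show 2 * c + 1 - c = c + 1 by omega]
      · rw [hsq, show 2 * h + 1 - (h + 1) = h by omega, mul_comm]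
  rw [lineBoundary, div_eq_one_iff_eq (quarter_pos hk).ne', ← hcard,
    Nat.cast_mul, Nat.cast_sub (by omega)]

lemma mul_div_two_eq (k N : ℕ) : k * N / 2 = k / 2 * N + k % 2 * (N / 2) := by
  rcases Nat.mod_two_eq_zero_or_one k with h | h <;> rw [h]
  · rw [← Nat.div_mul_right_comm (Nat.dvd_of_mod_eq_zero h), zero_mul, add_zero]
  · conv_lhs => rw [← Nat.div_add_mod k 2, h, add_mul, mul_assoc]
    omega

lemma lexBoundary_cons_half {k : ℕ} (hk : 2 ≤ k) {L : List ℕ} (hL : 0 < L.prod) :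
    lexBoundary (k :: L) ((k :: L).prod / 2) =
      L.prod + (k % 2 : ℕ) * lexBoundary L (L.prod / 2) := by
  have hone : ∀ θ ∈ range L.prod, lineBoundary k ((k * L.prod / 2 + θ) / L.prod) = 1 := by
    intro θ hθ
    have hlow : k / 2 * L.prod ≤ k * L.prod / 2 + θ := by
      rw [mul_div_two_eq]
      omega
    have hhigh : k * L.prod / 2 ≤ (k + 1) / 2 * L.prod := by
      refine Nat.div_le_of_le_mul ?_
      rw [← mul_assoc]
      exact Nat.mul_le_mul_right _ (by omega)
    exact lineBoundary_eq_one hk ((Nat.le_div_iff_mul_le hL).2 hlow)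
      (add_div_le_of_le_mul (mem_range.1 hθ) hhigh)
  have hmod : k * L.prod / 2 % L.prod = k % 2 * (L.prod / 2) := by
    rw [mul_div_two_eq, Nat.mul_add_mod']
    refine Nat.mod_eq_of_lt ?_
    rcases Nat.mod_two_eq_zero_or_one k with h | h <;> rw [h] <;> omega
  rw [lexBoundary, List.prod_cons, hmod, sum_congr rfl hone, sum_const, card_range, nsmul_one]
  rcases Nat.mod_two_eq_zero_or_one k with h | h <;> rw [h] <;> simp

lemma lexBoundary_half {d : ℕ} {k : Fin d → ℕ} (hk : ∀ i, 2 ≤ k i) :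
    lexBoundary (List.ofFn k) ((∏ i, k i) / 2) = Psi k (lowestEvenDim k) := by
  induction d with
  | zero => simp [Psi]
  | succ d ih =>
    have hpos : 0 < (List.ofFn fun i => k i.succ).prod := by
      rw [List.prod_ofFn]
      exact prod_pos fun i _ => two_pos.trans_le (hk i.succ)
    rw [← List.prod_ofFn, List.ofFn_succ, lexBoundary_cons_half (hk 0) hpos, Psi_lowestEvenDim_succ,
      List.prod_ofFn, ih fun i => hk i.succ]
    push_cast
    rfl

end HalfBoundary

section UpperBound

/-- `G` can be cut in the middle by one edge: into two halves if the number of vertices is even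
(then `A = B`), and on either side of a middle vertex if it is odd (then `B` is `A` together with
that vertex). -/
def HasMiddleCut {V : Type*} [Fintype V] (G : SimpleGraph V) : Prop :=
  ∃ A B : Finset V, A ⊆ B ∧ #A = Fintype.card V / 2 ∧ #B = (Fintype.card V + 1) / 2 ∧
    cutSize G A = 1 ∧ cutSize G B = 1

variable {d : ℕ}

/-- The points with first coordinate in `A`, together with those with first coordinate in `B` whose
remaining coordinates lie in `S`. -/
noncomputable def stackedSet {V : Fin (d + 1) → Type*} [∀ i, Fintype (V i)] (A B : Finset (V 0))
    (S : Finset (∀ i : Fin d, V i.succ)) : Finset (∀ i, V i) :=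
  open Classical in univ.filter fun x => x 0 ∈ A ∨ x 0 ∈ B ∧ Fin.tail x ∈ S

section StackedSet

variable {V : Fin (d + 1) → Type*} [∀ i, Fintype (V i)] {A B : Finset (V 0)}
  {S : Finset (∀ i : Fin d, V i.succ)}

lemma lineSlice_stackedSet_of_mem (hAB : A ⊆ B) {x : ∀ i : Fin d, V i.succ} (hx : x ∈ S) :
    lineSlice (stackedSet A B S) x = B := by
  ext t
  simpa [stackedSet, hx] using @hAB t

lemma lineSlice_stackedSet_of_notMem {x : ∀ i : Fin d, V i.succ} (hx : x ∉ S) :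
    lineSlice (stackedSet A B S) x = A := by
  ext t
  simp [stackedSet, hx]

lemma sum_tailSlice_stackedSet [DecidableEq (V 0)]
    {f : Finset (∀ i : Fin d, V i.succ) → ℕ} (hf : f ∅ = 0) :
    ∑ t, f (tailSlice (stackedSet A B S) t) = #A * f univ + #(B \ A) * f S := by
  have hslice : ∀ t, f (tailSlice (stackedSet A B S) t) =
      (if t ∈ A then f univ else 0) + if t ∈ B \ A then f S else 0 := by
    intro t
    by_cases hA : t ∈ A
    · have : tailSlice (stackedSet A B S) t = univ := by ext x; simp [stackedSet, hA]
      simp [this, hA]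
    by_cases hB : t ∈ B
    · have : tailSlice (stackedSet A B S) t = S := by ext x; simp [stackedSet, hA, hB]
      simp [this, hA, hB]
    · have : tailSlice (stackedSet A B S) t = ∅ := by ext x; simp [stackedSet, hA, hB]
      simp [this, hA, hB, hf]
  simp only [hslice, sum_add_distrib, sum_ite_mem, univ_inter, sum_const, smul_eq_mul]

end StackedSet

theorem exists_card_eq_half_cutSize_eq {V : Fin d → Type*} [∀ i, Fintype (V i)]
    {G : ∀ i, SimpleGraph (V i)} (hG : ∀ i, HasMiddleCut (G i)) :
    ∃ S : Finset (∀ i, V i), #S = Fintype.card (∀ i, V i) / 2 ∧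
      cutSize (cartesianProduct G) S =
        Psi (fun i => Fintype.card (V i)) (lowestEvenDim fun i => Fintype.card (V i)) := by
  classical
  induction d with
  | zero => exact ⟨∅, by simp, by simp [cutSize_empty, Psi]⟩
  | succ d ih =>
    obtain ⟨S, hS, hSc⟩ := ih fun i => hG i.succ
    obtain ⟨A, B, hAB, hA, hB, hAc, hBc⟩ := hG 0
    have hmiddle : #(B \ A) = Fintype.card (V 0) % 2 := by
      rw [card_sdiff_of_subset hAB]
      omega
    have hline : ∀ x, cutSize (G 0) (lineSlice (stackedSet A B S) x) = 1 := by
      intro x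
      by_cases hx : x ∈ S
      · rw [lineSlice_stackedSet_of_mem hAB hx, hBc]
      · rw [lineSlice_stackedSet_of_notMem hx, hAc]
    refine ⟨stackedSet A B S, ?_, ?_⟩
    · rw [card_eq_sum_tailSlice, sum_tailSlice_stackedSet card_empty, hmiddle, hS, hA,
        card_univ, Fintype.card_pi (α := V), Fin.prod_univ_succ, mul_div_two_eq, Fintype.card_pi]
    · rw [cutSize_cartesianProduct, sum_tailSlice_stackedSet (cutSize_empty _), cutSize_univ,
        mul_zero, zero_add, hmiddle, hSc, Psi_lowestEvenDim_succ, sum_congr rfl fun x _ => hline x,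
        sum_const, card_univ, Fintype.card_pi, smul_eq_mul, mul_one]

end UpperBound

section Factors

lemma cutSize_pathGraph {k h : ℕ} (h0 : 0 < h) (hk : h < k) :
    cutSize (SimpleGraph.pathGraph k) (univ.filter fun v : Fin k => (v : ℕ) < h) = 1 := by
  refine cutSize_eq_one (a := ⟨h - 1, by omega⟩) (b := ⟨h, hk⟩) ?_ (by simp) ?_ ?_
  · rw [mem_filter_univ]
    exact Nat.sub_one_lt_of_le h0 le_rfl
  · rw [SimpleGraph.pathGraph_adj]
    exact Or.inl (Nat.sub_add_cancel h0)
  · intro u hu v hv huv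
    rw [mem_filter_univ] at hu hv
    rw [SimpleGraph.pathGraph_adj] at huv
    simp only [Fin.ext_iff]
    omega

lemma hasMiddleCut_pathGraph {k : ℕ} (hk : 2 ≤ k) : HasMiddleCut (SimpleGraph.pathGraph k) := by
  refine ⟨univ.filter fun v => (v : ℕ) < k / 2, univ.filter fun v => (v : ℕ) < (k + 1) / 2,
    monotone_filter_right _ fun v _ hv => ?_, ?_, ?_, cutSize_pathGraph (by omega) (by omega),
    cutSize_pathGraph (by omega) (by omega)⟩
  · omega
  all_goals
    rw [Fin.card_filter_val_lt, Fintype.card_fin]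
    omega

lemma binaryTree_adj {k : ℕ} {u v : Fin k} : (binaryTree k).Adj u v ↔
    ((v : ℕ) = 2 * u + 1 ∨ (v : ℕ) = 2 * u + 2) ∨ (u : ℕ) = 2 * v + 1 ∨ (u : ℕ) = 2 * v + 2 := by
  rw [binaryTree, SimpleGraph.fromRel_adj, and_iff_right_iff_imp, ne_eq, Fin.ext_iff]
  omega

lemma binaryTree_preconnected (k : ℕ) : (binaryTree k).Preconnected := by
  have hroot : ∀ n (hn : n < k), (binaryTree k).Reachable ⟨n, hn⟩ ⟨0, by omega⟩ := by
    intro n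
    induction n using Nat.strong_induction_on with
    | _ n ih =>
      intro hn
      rcases n.eq_zero_or_pos with rfl | h0
      · exact SimpleGraph.Reachable.rfl
      · have hparent : (binaryTree k).Adj ⟨n, hn⟩ ⟨(n - 1) / 2, by omega⟩ := by
          rw [binaryTree_adj]
          dsimp only
          omega
        exact hparent.reachable.trans (ih _ (by omega) (by omega))
  exact fun u v => (hroot u u.isLt).trans (hroot v v.isLt).symm

/-- The left subtree of the root in the level order numbering by `1, 2, 3, …`: it consists of the
first halves of the levels `{2 * 2 ^ l, …, 4 * 2 ^ l - 1}` below the root. -/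
def IsLeft (v : ℕ) : Prop := ∃ l : ℕ, v ∈ Ico (2 * 2 ^ l) (3 * 2 ^ l)

lemma isLeft_two : IsLeft 2 := ⟨0, by simp⟩

lemma not_isLeft_one : ¬ IsLeft 1 := by
  rintro ⟨l, hl⟩
  have := l.one_le_two_pow
  rw [mem_Ico] at hl
  omega

lemma IsLeft.child {v w : ℕ} (h : IsLeft v) (hw : w = 2 * v ∨ w = 2 * v + 1) : IsLeft w := by
  obtain ⟨l, hl⟩ := h
  refine ⟨l + 1, ?_⟩
  rw [mem_Ico, pow_succ] at *
  omega

lemma IsLeft.parent {v w : ℕ} (h : IsLeft w) (hw : w = 2 * v ∨ w = 2 * v + 1) (hv : 2 ≤ v) :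
    IsLeft v := by
  obtain ⟨_ | l, hl⟩ := h <;> rw [mem_Ico] at hl
  · omega
  · refine ⟨l, ?_⟩
    rw [pow_succ] at hl
    rw [mem_Ico]
    omega

lemma not_isLeft_three : ¬ IsLeft 3 := by
  rintro ⟨_ | l, hl⟩
  · simp at hl
  · have := l.one_le_two_pow
    rw [mem_Ico, pow_succ] at hl
    omega

/-- The left subtree of the root of `binaryTree k`, whose vertices are numbered from `0`. -/
noncomputable def leftSubtree (k : ℕ) : Finset (Fin k) :=
  open Classical in univ.filter fun v => IsLeft (v + 1)

lemma mem_leftSubtree {k : ℕ} {v : Fin k} : v ∈ leftSubtree k ↔ IsLeft (v + 1) := by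
  simp [leftSubtree]

lemma log_two_eq_of_mem_Ico {l v : ℕ} (hv : v ∈ Ico (2 * 2 ^ l) (3 * 2 ^ l)) :
    Nat.log 2 v = l + 1 := by
  rw [mem_Ico] at hv
  have := pow_succ 2 l
  have := pow_succ 2 (l + 1)
  exact Nat.log_eq_of_pow_le_of_lt_pow (by omega) (by omega)

lemma map_leftSubtree {j k : ℕ} (hk : k + 1 = 2 ^ (j + 1)) :
    (leftSubtree k).map (Fin.valEmbedding.trans (addRightEmbedding 1)) =
      (range j).biUnion fun l => Ico (2 * 2 ^ l) (3 * 2 ^ l) := by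
  ext v
  simp only [mem_map, mem_leftSubtree, mem_biUnion, mem_range, Function.Embedding.trans_apply,
    Fin.valEmbedding_apply, addRightEmbedding_apply]
  constructor
  · rintro ⟨u, ⟨l, hl⟩, rfl⟩
    have hlog : Nat.log 2 (u + 1) < j + 1 := Nat.log_lt_of_lt_pow (by omega) (by omega)
    rw [log_two_eq_of_mem_Ico hl] at hlog
    exact ⟨l, Nat.lt_of_succ_lt_succ hlog, hl⟩
  · rintro ⟨l, hlj, hl⟩
    have hv : v < 2 ^ (j + 1) := Nat.lt_pow_of_log_lt one_lt_two (by
      rw [log_two_eq_of_mem_Ico hl]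
      omega)
    have hpos : 0 < v := (Nat.mul_pos two_pos (pow_pos two_pos l)).trans_le (mem_Ico.1 hl).1
    exact ⟨⟨v - 1, by omega⟩, ⟨l, by rwa [Nat.sub_add_cancel hpos]⟩, Nat.sub_add_cancel hpos⟩

lemma card_leftSubtree {j k : ℕ} (hk : k + 1 = 2 ^ (j + 1)) : #(leftSubtree k) = 2 ^ j - 1 := by
  have hdisjoint : (range j : Set ℕ).PairwiseDisjoint fun l => Ico (2 * 2 ^ l) (3 * 2 ^ l) :=
    fun l _ m _ hlm => disjoint_left.2 fun v hl hm => hlm <| Nat.succ_injective <|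
      (log_two_eq_of_mem_Ico hl).symm.trans (log_two_eq_of_mem_Ico hm)
  calc #(leftSubtree k) = ∑ l ∈ range j, #(Ico (2 * 2 ^ l) (3 * 2 ^ l)) := by
        rw [← card_map, map_leftSubtree hk, card_biUnion hdisjoint]
    _ = ∑ l ∈ range j, 2 ^ l := by simp only [Nat.card_Ico, ← Nat.sub_mul, Nat.reduceSub, one_mul]
    _ = 2 ^ j - 1 := by rw [Nat.geomSum_eq le_rfl, Nat.div_one]

lemma cutSize_leftSubtree {k : ℕ} (hk : 2 ≤ k) : cutSize (binaryTree k) (leftSubtree k) = 1 := by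
  refine cutSize_eq_one (a := ⟨1, by omega⟩) (b := ⟨0, by omega⟩) (mem_leftSubtree.2 isLeft_two)
    (mt mem_leftSubtree.1 not_isLeft_one) (by simp [binaryTree_adj]) fun u hu v hv huv => ?_
  rw [mem_leftSubtree] at hu hv
  rcases binaryTree_adj.1 huv with hchild | hparent
  · exact absurd (hu.child (by omega)) hv
  · have hv0 : (v : ℕ) = 0 := by
      by_contra hv0
      exact hv (hu.parent (by omega) (by omega))
    have hu2 : (u : ℕ) ≠ 2 := fun hu2 => not_isLeft_three (by rwa [hu2] at hu)
    simp only [Fin.ext_iff]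
    omega

lemma cutSize_insert_leftSubtree {k : ℕ} (hk : 3 ≤ k) {r : Fin k} (hr : (r : ℕ) = 0) :
    cutSize (binaryTree k) (insert r (leftSubtree k)) = 1 := by
  refine cutSize_eq_one (a := r) (b := ⟨2, by omega⟩) (mem_insert_self _ _) ?_
    (by simp [binaryTree_adj, hr]) fun u hu v hv huv => ?_
  · simpa [mem_leftSubtree, Fin.ext_iff, hr] using not_isLeft_three
  simp only [mem_insert, mem_leftSubtree, not_or, Fin.ext_iff] at hu hv ⊢
  rcases hu with hu | hu
  · have hv1 : (v : ℕ) ≠ 1 := fun hv1 => hv.2 (by rw [hv1]; exact isLeft_two)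
    have := binaryTree_adj.1 huv
    omega
  · rcases binaryTree_adj.1 huv with hchild | hparent
    · exact absurd (hu.child (by omega)) hv.2
    · exact absurd (hu.parent (by omega) (by omega)) hv.2

lemma hasMiddleCut_binaryTree {j k : ℕ} (hk : k + 1 = 2 ^ (j + 2)) :
    HasMiddleCut (binaryTree k) := by
  have hpow := j.one_le_two_pow
  have hpow2 : 2 ^ (j + 2) = 4 * 2 ^ j := by ring
  have hcard : #(leftSubtree k) = k / 2 := by
    rw [card_leftSubtree hk]
    omega
  obtain ⟨r, hr⟩ : ∃ r : Fin k, (r : ℕ) = 0 := ⟨⟨0, by omega⟩, rfl⟩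
  have hr_notMem : r ∉ leftSubtree k := by simpa [mem_leftSubtree, hr] using not_isLeft_one
  refine ⟨leftSubtree k, insert r (leftSubtree k), subset_insert _ _, ?_, ?_,
    cutSize_leftSubtree (by omega), cutSize_insert_leftSubtree (by omega) hr⟩
  · rw [hcard, Fintype.card_fin]
  · rw [card_insert_of_notMem hr_notMem, hcard, Fintype.card_fin]
    omega

variable {k : ℕ} {G : SimpleGraph (Fin k)}

lemma IsPathGraph.preconnected (hG : IsPathGraph G) : G.Preconnected := by
  rw [show G = _ from hG]
  exact SimpleGraph.pathGraph_preconnected k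

lemma IsPathGraph.hasMiddleCut (hG : IsPathGraph G) (hk : 2 ≤ k) : HasMiddleCut G := by
  rw [show G = _ from hG]
  exact hasMiddleCut_pathGraph hk

lemma IsCompleteBinaryTree.preconnected (hG : IsCompleteBinaryTree G) : G.Preconnected := by
  rw [hG.2]
  exact binaryTree_preconnected k

lemma IsCompleteBinaryTree.hasMiddleCut (hG : IsCompleteBinaryTree G) (hk : 2 ≤ k) :
    HasMiddleCut G := by
  obtain ⟨⟨j, -, rfl⟩, rfl⟩ := hG
  obtain _ | _ | j := j
  · simp at hk
  · simp at hk
  · exact hasMiddleCut_binaryTree (Nat.sub_add_cancel Nat.one_le_two_pow)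

end Factors

theorem bisectionWidth_eq {V : Type*} [Fintype V] {G : SimpleGraph V} {b : ℕ}
    (hle : ∀ S : Finset V, #S = Fintype.card V / 2 → b ≤ cutSize G S)
    (hex : ∃ S : Finset V, #S = Fintype.card V / 2 ∧ cutSize G S = b) : bisectionWidth G = b := by
  refine le_antisymm (Nat.sInf_le hex) (le_csInf ⟨b, hex⟩ ?_)
  rintro _ ⟨S, hS, rfl⟩
  exact hle S hS

end MCTP

theorem mainTheorem1_general {d : ℕ} {V : Fin d → Type*} [∀ i, Fintype (V i)]
    (hV : ∀ i, 2 ≤ Fintype.card (V i)) (hmono : Antitone fun i => Fintype.card (V i))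
    {G : ∀ i, SimpleGraph (V i)} (hconn : ∀ i, (G i).Preconnected)
    (hmid : ∀ i, MCTP.HasMiddleCut (G i)) :
    MCTP.bisectionWidth (MCTP.cartesianProduct G) =
      MCTP.Psi (fun i => Fintype.card (V i))
        (MCTP.lowestEvenDim fun i => Fintype.card (V i)) := by
  refine MCTP.bisectionWidth_eq (fun S hS => ?_) (MCTP.exists_card_eq_half_cutSize_eq hmid)
  have hcut := MCTP.lexBoundary_le_cutSize hV hmono hconn S
  rw [hS, Fintype.card_pi, MCTP.lexBoundary_half hV] at hcut
  exact_mod_cast hcut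

theorem mainTheorem1 (d : ℕ) (hd : 1 ≤ d) (k : Fin d → ℕ)
    (hk : ∀ i, 2 ≤ k i) (hmono : ∀ i j, i ≤ j → k j ≤ k i)
    (G : ∀ i, SimpleGraph (Fin (k i)))
    (hG : ∀ i, MCTP.IsCompleteBinaryTree (G i) ∨ MCTP.IsPathGraph (G i)) :
    MCTP.bisectionWidth (MCTP.cartesianProduct G) = MCTP.Psi k (MCTP.lowestEvenDim k) := by
  simpa only [Fintype.card_fin] using mainTheorem1_general (G := G) (by simpa using hk)
    (by simpa [Antitone] using hmono) (fun i => (hG i).elim (·.preconnected) (·.preconnected))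
    fun i => (hG i).elim (·.hasMiddleCut (hk i)) (·.hasMiddleCut (hk i))
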